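/- Let $D \ge 2$ and let $T^{\mu\nu}$ be a smooth ($C^\infty$) contravariant tensor field of degree $2$ on $\mathbb{R}^D$ (components with respect to the canonical coordinates $x^1,\dots,x^D$, with $\partial_\mu = \partial/\partial x^\mu$ and summation over repeated indices) which is symmetric, $T^{\mu\nu} = T^{\nu\mu}$, and divergence-free, $\partial_\mu T^{\mu\nu} = 0$ for all $\nu$. Then there is a smooth contravariant tensor field $R^{\lambda\mu\rho\nu}$ of degree $4$ on $\mathbb{R}^D$ with the algebraic symmetries of the Riemann curvature tensor, namely $$R^{\lambda\mu\rho\nu} = -R^{\mu\lambda\rho\nu} = -R^{\lambda\mu\nu\rho}, \qquad R^{\lambda\mu\rho\nu} = R^{\rho\nu\lambda\mu}, \qquad R^{\lambda\mu\rho\nu} + R^{\lambda\rho\nu\mu} + R^{\lambda\nu\mu\rho} = 0,$$ such that $$T^{\mu\nu} = \partial_\lambda \partial_\rho R^{\lambda\mu\rho\nu}$$ for all $\mu, \nu$ at every point of $\mathbb{R}^D$. -/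

import Mathlib

open scoped ContDiff

/-- A contravariant tensor field of degree `2` on `ℝ^D`, given by its components in the canonical
coordinates: `T x μ ν` is the component `T^{μν}(x)`. -/
abbrev TensorField2 (D : ℕ) : Type := (Fin D → ℝ) → Fin D → Fin D → ℝ

/-- A contravariant tensor field of degree `4` on `ℝ^D`, given by its components in the canonical
coordinates: `R x l m r n` is the component `R^{lmrn}(x)`. -/
abbrev TensorField4 (D : ℕ) : Type := (Fin D → ℝ) → Fin D → Fin D → Fin D → Fin D → ℝ

/-- The partial derivative `∂_μ f` with respect to the canonical coordinate `x^μ` of `ℝ^D`. -/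
noncomputable def partialDeriv {D : ℕ} (m : Fin D) (f : (Fin D → ℝ) → ℝ) : (Fin D → ℝ) → ℝ :=
  fun x => fderiv ℝ f x (Pi.single m 1)

/-- `T^{μν} = T^{νμ}`. -/
def IsSymmetricField {D : ℕ} (T : TensorField2 D) : Prop :=
  ∀ x m n, T x m n = T x n m

/-- `∂_μ T^{μν} = 0` (summed over `μ`), for every `ν` and at every point. -/
def IsDivergenceFree {D : ℕ} (T : TensorField2 D) : Prop :=
  ∀ (n : Fin D) (x : Fin D → ℝ), ∑ m, partialDeriv m (fun y => T y m n) x = 0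

/-- The algebraic symmetries of the Riemann curvature tensor, at every point: antisymmetry in the
first pair and in the second pair of indices, symmetry under exchange of the two pairs, and the
first (algebraic) Bianchi identity. -/
structure HasRiemannSymmetries {D : ℕ} (R : TensorField4 D) : Prop where
  antisymm_left : ∀ x l m r n, R x l m r n = -R x m l r n
  antisymm_right : ∀ x l m r n, R x l m r n = -R x l m n r
  pair_symm : ∀ x l m r n, R x l m r n = R x r n l m
  bianchi : ∀ x l m r n, R x l m r n + R x l r n m + R x l n m r = 0

/-- The tensor field `∂_λ ∂_ρ R^{λμρν}` of degree `2` (summed over `λ` and `ρ`). -/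
noncomputable def doubleDivergence {D : ℕ} (R : TensorField4 D) : TensorField2 D :=
  fun x m n => ∑ l, ∑ r, partialDeriv l (partialDeriv r (fun y => R y l m r n)) x

/-! The Poincaré lemma for divergence-free vector fields is used twice. For fixed `n`, it gives
`T^{mn} = ∂_l A_n^{lm}`. Symmetry of `T` makes `F^{lmn} = A_n^{lm} - A_m^{ln}` divergence-free in
`l`, so `F^{lmn} = ∂_r B^{rlmn}`, with `B` antisymmetric in each pair. Since `A` is a linear
combination of permutations of `F`, `T` is a double divergence of permuted copies of `B`
(`exists_bi_antisymm_potential`). It remains to symmetrize under exchange of pairs and remove the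
totally antisymmetric part, which the symmetric operator `∂_l ∂_r` annihilates. -/

open MeasureTheory in
theorem hasFDerivAt_intervalIntegral_of_contDiff {H E : Type} [NormedAddCommGroup H]
    [NormedSpace ℝ H] [ProperSpace H] [NormedAddCommGroup E] [NormedSpace ℝ E] [CompleteSpace E]
    {f : H × ℝ → E} (hf : ContDiff ℝ 1 f) (a b : ℝ) (x : H) :
    HasFDerivAt (fun y => ∫ t in a..b, f (y, t))
      (∫ t in a..b, (fderiv ℝ f (x, t)).comp (ContinuousLinearMap.inl ℝ H ℝ)) x := by
  have hf' : Continuous fun p : H × ℝ =>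
      (fderiv ℝ f p).comp (ContinuousLinearMap.inl ℝ H ℝ) :=
    (hf.continuous_fderiv one_ne_zero).clm_comp continuous_const
  -- A constant dominates the derivative, by compactness of the ball times the interval.
  obtain ⟨C, hC⟩ := ((isCompact_closedBall x 1).prod (isCompact_uIcc (a := a) (b := b)))
    |>.exists_bound_of_continuousOn hf'.continuousOn
  refine intervalIntegral.hasFDerivAt_integral_of_dominated_of_fderiv_le (𝕜 := ℝ)
    (F' := fun y t => (fderiv ℝ f (y, t)).comp (ContinuousLinearMap.inl ℝ H ℝ))
    (bound := fun _ => C) (Metric.closedBall_mem_nhds x one_pos) ?_ ?_ ?_ ?_ ?_ ?_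
  · exact .of_forall fun y =>
      (hf.continuous.comp (Continuous.prodMk_right y)).aestronglyMeasurable
  · exact (hf.continuous.comp (Continuous.prodMk_right x)).intervalIntegrable _ _
  · exact (hf'.comp (Continuous.prodMk_right x)).aestronglyMeasurable
  · exact .of_forall fun t ht y hy => hC (y, t) ⟨hy, Set.uIoc_subset_uIcc ht⟩
  · exact intervalIntegrable_const
  · exact .of_forall fun t _ y _ =>
      ((hf.differentiable one_ne_zero).differentiableAt.hasFDerivAt (x := (y, t))).comp y
        (hasFDerivAt_prodMk_left y t)

/-- `E` is quantified after `n` because the induction step passes to the derivative, whose values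
lie in `H →L[ℝ] E`. -/
theorem contDiff_intervalIntegral_nat {H : Type} [NormedAddCommGroup H] [NormedSpace ℝ H]
    [ProperSpace H] (a b : ℝ) (n : ℕ) :
    ∀ {E : Type} [NormedAddCommGroup E] [NormedSpace ℝ E] [CompleteSpace E] {f : H × ℝ → E},
      ContDiff ℝ ∞ f → ContDiff ℝ n fun y => ∫ t in a..b, f (y, t) := by
  induction n with
  | zero =>
    intro E _ _ _ f hf
    exact contDiff_zero.2 <|
      intervalIntegral.continuous_parametric_intervalIntegral_of_continuous' (f := fun y t => f (y, t)) hf.continuous a b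
  | succ n ih =>
    intro E _ _ _ f hf
    have hd := hasFDerivAt_intervalIntegral_of_contDiff (hf.of_le (by simp)) a b
    push_cast
    refine contDiff_succ_iff_fderiv.2 ⟨fun y => (hd y).differentiableAt, by simp, ?_⟩
    rw [funext fun y => (hd y).fderiv]
    exact ih (f := fun p => (fderiv ℝ f p).comp (ContinuousLinearMap.inl ℝ H ℝ))
      ((hf.fderiv_right (by simp)).clm_comp contDiff_const)

theorem contDiff_intervalIntegral {H E : Type} [NormedAddCommGroup H] [NormedSpace ℝ H]
    [ProperSpace H] [NormedAddCommGroup E] [NormedSpace ℝ E] [CompleteSpace E] {f : H × ℝ → E}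
    (hf : ContDiff ℝ ∞ f) (a b : ℝ) : ContDiff ℝ ∞ fun y => ∫ t in a..b, f (y, t) :=
  contDiff_infty.2 fun n => contDiff_intervalIntegral_nat a b n hf

section PartialDeriv

variable {D : ℕ} {f g : (Fin D → ℝ) → ℝ}

theorem ContDiff.partialDeriv (hf : ContDiff ℝ ∞ f) (m : Fin D) :
    ContDiff ℝ ∞ (partialDeriv m f) :=
  (hf.fderiv_right (by simp)).clm_apply contDiff_const

theorem ContDiff.differentiable_of_infty (hf : ContDiff ℝ ∞ f) : Differentiable ℝ f :=
  hf.differentiable (by simp)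

theorem partialDeriv_add (hf : ContDiff ℝ ∞ f) (hg : ContDiff ℝ ∞ g) (m : Fin D) :
    partialDeriv m (fun y => f y + g y) = fun x => partialDeriv m f x + partialDeriv m g x := by
  ext x
  simp [partialDeriv, fderiv_fun_add (hf.differentiable_of_infty x) (hg.differentiable_of_infty x)]

theorem partialDeriv_sub (hf : ContDiff ℝ ∞ f) (hg : ContDiff ℝ ∞ g) (m : Fin D) :
    partialDeriv m (fun y => f y - g y) = fun x => partialDeriv m f x - partialDeriv m g x := by
  ext x
  simp [partialDeriv, fderiv_fun_sub (hf.differentiable_of_infty x) (hg.differentiable_of_infty x)]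

theorem partialDeriv_const_mul (hf : ContDiff ℝ ∞ f) (c : ℝ) (m : Fin D) :
    partialDeriv m (fun y => c * f y) = fun x => c * partialDeriv m f x := by
  ext x
  simp [partialDeriv, fderiv_const_mul (hf.differentiable_of_infty x)]

theorem partialDeriv_neg (m : Fin D) :
    partialDeriv m (fun y => -f y) = fun x => -partialDeriv m f x := by
  ext x
  simp [partialDeriv, fderiv_fun_neg]

theorem partialDeriv_sum {ι : Type} [Fintype ι] {F : ι → (Fin D → ℝ) → ℝ}
    (hF : ∀ i, ContDiff ℝ ∞ (F i)) (m : Fin D) :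
    partialDeriv m (fun y => ∑ i, F i y) = fun x => ∑ i, partialDeriv m (F i) x := by
  ext x
  simp [partialDeriv, fderiv_fun_sum fun i _ => (hF i).differentiable_of_infty x]

theorem partialDeriv_mul (hf : ContDiff ℝ ∞ f) (hg : ContDiff ℝ ∞ g) (m : Fin D) :
    partialDeriv m (fun y => f y * g y) =
      fun x => partialDeriv m f x * g x + f x * partialDeriv m g x := by
  ext x
  simp [partialDeriv, fderiv_fun_mul (hf.differentiable_of_infty x) (hg.differentiable_of_infty x)]
  ring

theorem partialDeriv_coord (l m : Fin D) (x : Fin D → ℝ) :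
    partialDeriv m (fun y => y l) x = if l = m then 1 else 0 := by
  simp [partialDeriv, (hasFDerivAt_apply (𝕜 := ℝ) l x).fderiv, Pi.single_apply]

theorem partialDeriv_comp_smul (hf : ContDiff ℝ ∞ f) (t : ℝ) (m : Fin D) (x : Fin D → ℝ) :
    partialDeriv m (fun y => f (t • y)) x = t * partialDeriv m f (t • x) := by
  have h : HasFDerivAt (fun y : Fin D → ℝ => t • y)
      (t • ContinuousLinearMap.id ℝ (Fin D → ℝ)) x := (hasFDerivAt_id x).const_smul t
  have := ((hf.differentiable_of_infty (t • x)).hasFDerivAt.comp x h).fderiv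
  simp only [Function.comp_def] at this
  simp [partialDeriv, this]

theorem partialDeriv_comm (hf : ContDiff ℝ ∞ f) (l m : Fin D) (x : Fin D → ℝ) :
    partialDeriv l (partialDeriv m f) x = partialDeriv m (partialDeriv l f) x := by
  have hd : DifferentiableAt ℝ (fderiv ℝ f) x :=
    (hf.fderiv_right (m := ∞) (by simp)).differentiable (by simp) x
  have key (v w : Fin D → ℝ) :
      fderiv ℝ (fun y => fderiv ℝ f y v) x w = fderiv ℝ (fderiv ℝ f) x w v := by
    rw [fderiv_clm_apply hd (differentiableAt_const v)]
    simp
  change fderiv ℝ (fun y => fderiv ℝ f y _) x _ = fderiv ℝ (fun y => fderiv ℝ f y _) x _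
  rw [key, key]
  exact ((hf.of_le (m := 2) ENat.LEInfty.out).contDiffAt
    |>.isSymmSndFDerivAt (by simp)) _ _

theorem fderiv_eq_sum_partialDeriv (x v : Fin D → ℝ) :
    fderiv ℝ f x v = ∑ m, v m * partialDeriv m f x := by
  conv_lhs => rw [pi_eq_sum_univ' v]
  simp [partialDeriv]

theorem partialDeriv_intervalIntegral {F : (Fin D → ℝ) × ℝ → ℝ} (hF : ContDiff ℝ ∞ F) (a b : ℝ)
    (m : Fin D) (x : Fin D → ℝ) :
    partialDeriv m (fun y => ∫ t in a..b, F (y, t)) x =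
      ∫ t in a..b, partialDeriv m (fun y => F (y, t)) x := by
  have h1 : ContDiff ℝ 1 F := hF.of_le (by simp)
  have hc : Continuous fun t : ℝ =>
      (fderiv ℝ F (x, t)).comp (ContinuousLinearMap.inl ℝ (Fin D → ℝ) ℝ) :=
    ((h1.continuous_fderiv one_ne_zero).comp (Continuous.prodMk_right x)).clm_comp continuous_const
  rw [partialDeriv, (hasFDerivAt_intervalIntegral_of_contDiff h1 a b x).fderiv,
    ContinuousLinearMap.intervalIntegral_apply (hc.intervalIntegrable _ _)]
  refine intervalIntegral.integral_congr fun t _ => ?_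
  have := ((h1.differentiable one_ne_zero).differentiableAt.hasFDerivAt (x := (x, t))).comp x
    (hasFDerivAt_prodMk_left (𝕜 := ℝ) x t)
  simp only [Function.comp_def] at this
  simp only [partialDeriv, this.fderiv]

end PartialDeriv

/-- The Poincaré lemma for divergence-free vector fields on `ℝ^D` with `2 ≤ D`. -/
theorem exists_antisymm_potential {D : ℕ} (hD : 2 ≤ D) {V : Fin D → (Fin D → ℝ) → ℝ}
    (hV : ∀ m, ContDiff ℝ ∞ (V m)) (hdiv : ∀ x, ∑ m, partialDeriv m (V m) x = 0) :
    ∃ A : Fin D → Fin D → (Fin D → ℝ) → ℝ, (∀ l m, ContDiff ℝ ∞ (A l m)) ∧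
      (∀ l m x, A l m x = -A m l x) ∧ ∀ m x, V m x = ∑ l, partialDeriv l (A l m) x := by
  obtain ⟨k, rfl⟩ := Nat.exists_eq_add_of_le' hD
  -- Integrand of the radial homotopy formula; the weight is `t ^ (D - 2)`, which is where `2 ≤ D`
  -- enters.
  set G : Fin (k + 2) → Fin (k + 2) → (Fin (k + 2) → ℝ) × ℝ → ℝ := fun l m p =>
    p.2 ^ k * (p.1 l * V m (p.2 • p.1) - p.1 m * V l (p.2 • p.1)) with hGdef
  have hcomp (m) : ContDiff ℝ ∞ fun p : (Fin (k + 2) → ℝ) × ℝ => V m (p.2 • p.1) :=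
    (hV m).comp (contDiff_snd.smul contDiff_fst)
  have hG (l m) : ContDiff ℝ ∞ (G l m) :=
    (contDiff_snd.pow k).mul
      ((((contDiff_apply ℝ ℝ l).comp contDiff_fst).mul (hcomp m)).sub
        (((contDiff_apply ℝ ℝ m).comp contDiff_fst).mul (hcomp l)))
  refine ⟨fun l m y => ∫ t in (0 : ℝ)..1, G l m (y, t),
    fun l m => contDiff_intervalIntegral (hG l m) 0 1, fun l m x => ?_, fun m x => ?_⟩
  · rw [← intervalIntegral.integral_neg]
    refine intervalIntegral.integral_congr fun t _ => ?_
    simp only [hGdef]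
    ring
  have hGd (l) (t : ℝ) : partialDeriv l (fun y => G l m (y, t)) x =
      t ^ k * ((V m (t • x) + t * (x l * partialDeriv l (V m) (t • x)))
        - ((if l = m then V l (t • x) else 0) + t * (x m * partialDeriv l (V l) (t • x)))) := by
    have hs (j) : ContDiff ℝ ∞ fun y => V j (t • y) := (hV j).comp (contDiff_const_smul t)
    have hx (j : Fin (k + 2)) : ContDiff ℝ ∞ fun y : Fin (k + 2) → ℝ => y j :=
      contDiff_apply ℝ ℝ j
    simp only [hGdef]
    rw [partialDeriv_const_mul (((hx l).mul (hs m)).sub ((hx m).mul (hs l))),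
      partialDeriv_sub ((hx l).mul (hs m)) ((hx m).mul (hs l)),
      partialDeriv_mul (hx l) (hs m), partialDeriv_mul (hx m) (hs l)]
    simp only [partialDeriv_coord, partialDeriv_comp_smul (hV _), if_true]
    rcases eq_or_ne l m with rfl | h
    · simp
    · simp only [h, h.symm, if_false]
      ring
  -- The divergence of `G` is an exact `t`-derivative: the trace contributes `D - 1 = k + 1` and the
  -- `∂_l V^l` term drops. The primitive vanishes at `0` and equals `V m x` at `1`.
  have hder (t : ℝ) : HasDerivAt (fun s : ℝ => s ^ (k + 1) * V m (s • x))
      (∑ l, partialDeriv l (fun y => G l m (y, t)) x) t := by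
    have h1 : HasDerivAt (fun s : ℝ => s • x) x t := by
      simpa using (hasDerivAt_id t).smul_const x
    have h2 := ((hV m).differentiable_of_infty (t • x)).hasFDerivAt.comp_hasDerivAt t h1
    refine ((hasDerivAt_pow (k + 1) t).mul h2).congr_deriv ?_
    simp only [hGd, ← Finset.mul_sum, Finset.sum_sub_distrib, Finset.sum_add_distrib, hdiv,
      fderiv_eq_sum_partialDeriv]
    simp
    ring
  have hcont (l) : Continuous fun t : ℝ => partialDeriv l (fun y => G l m (y, t)) x := by
    have h1 (f : (Fin (k + 2) → ℝ) → ℝ) (hf : ContDiff ℝ ∞ f) :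
        Continuous fun t : ℝ => f (t • x) :=
      hf.continuous.comp (continuous_id.smul continuous_const)
    have h2 := h1 _ (hV m)
    have h3 := h1 _ ((hV m).partialDeriv l)
    have h4 := h1 _ ((hV l).partialDeriv l)
    have h5 := h1 _ (hV l)
    simp only [hGd]
    split_ifs <;> fun_prop
  simp only [partialDeriv_intervalIntegral (hG _ m)]
  rw [← intervalIntegral.integral_finsetSum fun l _ => (hcont l).intervalIntegrable 0 1,
    intervalIntegral.integral_eq_sub_of_hasDerivAt (fun t _ => hder t)
      ((continuous_finsetSum _ fun l _ => hcont l).intervalIntegrable 0 1)]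
  simp

/-- A smooth symmetric divergence-free field is, up to an algebraic rearrangement, the double
divergence of a field antisymmetric in each of its two pairs of indices. -/
theorem exists_bi_antisymm_potential {D : ℕ} (hD : 2 ≤ D) {T : TensorField2 D}
    (hT : ContDiff ℝ ∞ T) (hsymm : IsSymmetricField T) (hdiv : IsDivergenceFree T) :
    ∃ B : Fin D → Fin D → Fin D → Fin D → (Fin D → ℝ) → ℝ,
      (∀ r l m n, ContDiff ℝ ∞ (B r l m n)) ∧
      (∀ r l m n x, B r l m n x = -B l r m n x) ∧ (∀ r l m n x, B r l m n x = -B r l n m x) ∧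
      ∀ x m n, T x m n = 1 / 2 * ∑ l, ∑ r, (partialDeriv l (partialDeriv r (B r l m n)) x +
        partialDeriv l (partialDeriv r (B r m n l)) x -
        partialDeriv l (partialDeriv r (B r n l m)) x) := by
  have hT' (m n) : ContDiff ℝ ∞ fun x => T x m n := contDiff_pi.1 (contDiff_pi.1 hT m) n
  choose A hA hAs hAd using fun n =>
    exists_antisymm_potential hD (V := fun m x => T x m n) (fun m => hT' m n) (hdiv n)
  have hF (l m n) : ContDiff ℝ ∞ fun x => A n l m x - A m l n x := (hA n l m).sub (hA m l n)
  choose B hB hBs hBd using fun m n =>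
    exists_antisymm_potential hD (V := fun l x => A n l m x - A m l n x) (fun l => hF l m n)
      fun x => by
        simp only [partialDeriv_sub (hA _ _ _) (hA _ _ _), Finset.sum_sub_distrib]
        rw [← hAd n m x, ← hAd m n x, hsymm, sub_self]
  -- Antisymmetrizing in `m, n` keeps `B` a potential of `F`, as `F` is itself antisymmetric there.
  have hB' (r l m n) : ContDiff ℝ ∞ fun x => 1 / 2 * (B m n r l x - B n m r l x) :=
    contDiff_const.mul ((hB m n r l).sub (hB n m r l))
  have hFB (l m n) : (fun x => A n l m x - A m l n x) =
      fun x => ∑ r, partialDeriv r (fun x => 1 / 2 * (B m n r l x - B n m r l x)) x := by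
    ext x
    simp only [partialDeriv_const_mul ((hB m n _ l).sub (hB n m _ l)),
      partialDeriv_sub (hB m n _ l) (hB n m _ l), ← Finset.mul_sum, Finset.sum_sub_distrib,
      ← hBd m n l x, ← hBd n m l x]
    ring
  refine ⟨fun r l m n x => 1 / 2 * (B m n r l x - B n m r l x), hB', fun r l m n x => ?_,
    fun r l m n x => by ring, fun x m n => ?_⟩
  · beta_reduce
    rw [hBs m n r l, hBs n m r l]
    ring
  have hdF (l a b c) : ∑ r, partialDeriv l
      (partialDeriv r fun x => 1 / 2 * (B b c r a x - B c b r a x)) x =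
      partialDeriv l (A c a b) x - partialDeriv l (A b a c) x := by
    rw [← congrFun (partialDeriv_sum (fun r => (hB' r a b c).partialDeriv r) l) x, ← hFB,
      partialDeriv_sub (hA _ _ _) (hA _ _ _)]
  have hAn (l a b c) : partialDeriv l (A c a b) x = -partialDeriv l (A c b a) x := by
    rw [show A c a b = fun y => -A c b a y from funext (hAs c a b), partialDeriv_neg]
  simp only [Finset.sum_add_distrib, Finset.sum_sub_distrib, hdF]
  rw [hAd n m x, ← Finset.sum_sub_distrib, ← Finset.sum_sub_distrib]
  simp only [← Finset.sum_sub_distrib, ← Finset.sum_add_distrib, Finset.mul_sum]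
  refine Finset.sum_congr rfl fun l _ => ?_
  -- As for contorsion and torsion, `2 A_n^{lm} = F^{lmn} + F^{mnl} - F^{nlm}`.
  linarith [hAn l l m n, hAn l l n m, hAn l m n l]

theorem mainTheorem3 (D : ℕ) (hD : 2 ≤ D) (T : TensorField2 D) (hT : ContDiff ℝ ∞ T)
    (hsymm : IsSymmetricField T) (hdiv : IsDivergenceFree T) :
    ∃ R : TensorField4 D, ContDiff ℝ ∞ R ∧ HasRiemannSymmetries R ∧
      ∀ x m n, T x m n = doubleDivergence R x m n := by
  obtain ⟨B, hB, h12, h34, hTB⟩ := exists_bi_antisymm_potential hD hT hsymm hdiv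
  have hpair (l m r n) : ContDiff ℝ ∞ fun x => B l m r n x + B r n l m x :=
    (hB l m r n).add (hB r n l m)
  have hrest (l m r n) : ContDiff ℝ ∞ fun x =>
      (B l r n m x + B n m l r x) + (B l n m r x + B m r l n x) :=
    (hpair l r n m).add (hpair l n m r)
  -- With `P^{lmrn} = -1/2 (B^{lmrn} + B^{rnlm})`, whose double divergence is already `T`, this is
  -- `P` minus one third of its cyclic sum over `m, r, n`, which enforces Bianchi.
  refine ⟨fun x l m r n => -1 / 3 * (B l m r n x + B r n l m x) +
    1 / 6 * ((B l r n m x + B n m l r x) + (B l n m r x + B m r l n x)), ?_, ?_, ?_⟩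
  · refine contDiff_pi.2 fun l => contDiff_pi.2 fun m => contDiff_pi.2 fun r =>
      contDiff_pi.2 fun n => ?_
    exact (contDiff_const.mul (hpair l m r n)).add (contDiff_const.mul (hrest l m r n))
  · constructor <;> intro x l m r n <;> grind
  · intro x m n
    have hW (l r a b c d) : partialDeriv l (partialDeriv r (B a b c d)) x =
        partialDeriv r (partialDeriv l (B a b c d)) x := partialDeriv_comm (hB a b c d) l r x
    have hW12 (l r a b c d) : partialDeriv l (partialDeriv r (B a b c d)) x =
        -partialDeriv l (partialDeriv r (B b a c d)) x := by
      rw [show B a b c d = fun y => -B b a c d y from funext (h12 a b c d)]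
      simp only [partialDeriv_neg]
    have hW34 (l r a b c d) : partialDeriv l (partialDeriv r (B a b c d)) x =
        -partialDeriv l (partialDeriv r (B a b d c)) x := by
      rw [show B a b c d = fun y => -B a b d c y from funext (h34 a b c d)]
      simp only [partialDeriv_neg]
    have hadd (l r : Fin D) {f g : (Fin D → ℝ) → ℝ} (hf : ContDiff ℝ ∞ f)
        (hg : ContDiff ℝ ∞ g) : partialDeriv l (partialDeriv r fun y => f y + g y) x =
        partialDeriv l (partialDeriv r f) x + partialDeriv l (partialDeriv r g) x := by
      rw [partialDeriv_add hf hg, partialDeriv_add (hf.partialDeriv r) (hg.partialDeriv r)]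
    have hmul (l r : Fin D) (c : ℝ) {f : (Fin D → ℝ) → ℝ} (hf : ContDiff ℝ ∞ f) :
        partialDeriv l (partialDeriv r fun y => c * f y) x =
        c * partialDeriv l (partialDeriv r f) x := by
      rw [partialDeriv_const_mul hf, partialDeriv_const_mul (hf.partialDeriv r)]
    simp only [doubleDivergence]
    simp only [hadd _ _ (contDiff_const.mul (hpair _ _ _ _)) (contDiff_const.mul (hrest _ _ _ _)),
      hmul _ _ _ (hpair _ _ _ _), hmul _ _ _ (hrest _ _ _ _),
      hadd _ _ (hpair _ _ _ _) (hpair _ _ _ _), hadd _ _ (hB _ _ _ _) (hB _ _ _ _)]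
    rw [hTB]
    simp only [Finset.sum_add_distrib, Finset.sum_sub_distrib, ← Finset.mul_sum]
    set W : Fin D → Fin D → Fin D → Fin D → Fin D → Fin D → ℝ :=
      fun l r a b c d => partialDeriv l (partialDeriv r (B a b c d)) x with hWdef
    change ∀ l r a b c d, W l r a b c d = W r l a b c d at hW
    change ∀ l r a b c d, W l r a b c d = -W l r b a c d at hW12
    change ∀ l r a b c d, W l r a b c d = -W l r a b d c at hW34
    change 1 / 2 * (∑ l, ∑ r, W l r r l m n + ∑ l, ∑ r, W l r r m n l - ∑ l, ∑ r, W l r r n l m) =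
      -1 / 3 * (∑ l, ∑ r, W l r l m r n + ∑ l, ∑ r, W l r r n l m) +
      1 / 6 * (∑ l, ∑ r, W l r l r n m + ∑ l, ∑ r, W l r n m l r +
        (∑ l, ∑ r, W l r l n m r + ∑ l, ∑ r, W l r m r l n))
    have hswap (P Q : Fin D → Fin D → ℝ) (h : ∀ l r, P l r = -Q r l) :
        ∑ l, ∑ r, P l r = -∑ l, ∑ r, Q l r := by
      rw [Finset.sum_comm]
      simp only [h, Finset.sum_neg_distrib]
    -- Relabelling `l ↔ r` kills the sums in `e1`, `e3`, `e4` and reduces the others to the two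
    -- contractions of `B^{lmrn}` and `B^{rnlm}`.
    have e1 := hswap (fun l r => W l r r l m n) (fun l r => W l r r l m n)
      fun l r => by rw [hW, hW12]
    have e2 := hswap (fun l r => W l r r m n l) (fun l r => W l r l m r n)
      fun l r => by rw [hW, hW34]
    have e3 := hswap (fun l r => W l r l r n m) (fun l r => W l r l r n m)
      fun l r => by rw [hW, hW12]
    have e4 := hswap (fun l r => W l r n m l r) (fun l r => W l r n m l r)
      fun l r => by rw [hW, hW34]
    have e5 := hswap (fun l r => W l r l n m r) (fun l r => W l r r n l m)
      fun l r => by rw [hW, hW34]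
    have e6 := hswap (fun l r => W l r m r l n) (fun l r => W l r l m r n)
      fun l r => by rw [hW, hW12]
    linarith
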